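/- Let $G$ be a connected compact Lie group equipped with a bi-invariant Riemannian metric, with Lie algebra $\mathcal G=T_eG$ (a Euclidean space). Let $E$ be a Riemannian manifold on which $G$ acts smoothly, isometrically and transitively, such that the metric of $E$ is the quotient metric, i.e. for some point $o\in E$ the orbit map $G\to E$, $g\mapsto g\cdot o$, is a Riemannian submersion. Let $G_1,\dots,G_m$ be connected (not necessarily closed) Lie subgroups of $G$ with Lie algebras $\mathcal G_i\subset\mathcal G$, let $\mathcal E_i:=\mathcal G_i^{\perp}\subset\mathcal G$, and let $d_1,\dots,d_m>0$. A function $f:E\to\mathbb R$ is called $G_i$-invariant if $f(g\cdot x)=f(x)$ for all $x\in E$ and $g\in G_i$; for $x\in E$ put $$\mathcal E_i(x):=\{\nabla f(x)\;;\; f:E\to\mathbb R \text{ is } G_i\text{-invariant and differentiable at } x\}\subset T_xE .$$ Write $P_{F}$ for the orthogonal projection onto a subspace $F$ of a Euclidean space. If $$\sum_{i=1}^m d_i P_{\mathcal E_i}\le \mathrm{Id}_{\mathcal G}$$ as symmetric linear maps of $\mathcal G$, then for every $x\in E$ $$\sum_{i=1}^m d_i P_{\mathcal E_i(x)}\le \mathrm{Id}_{T_xE}$$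 as symmetric linear maps of $T_xE$. -/

import Mathlib

open Bundle
open scoped Manifold ContDiff InnerProductSpace

/-- Tangent spaces of a finite-dimensional manifold are finite-dimensional. -/
instance TangentSpace.instFiniteDimensionalReal {V : Type*} [NormedAddCommGroup V]
    [NormedSpace ℝ V] [FiniteDimensional ℝ V] {M : Type*} [TopologicalSpace M]
    [ChartedSpace V M] (x : M) : FiniteDimensional ℝ (TangentSpace 𝓘(ℝ, V) x) :=
  inferInstanceAs (FiniteDimensional ℝ V)

/-- `F : M → N` preserves the Riemannian metrics: each differential `dF_x : T_x M → T_{F x} N`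
preserves the inner product. -/
def PreservesRiemannianMetric (V W : Type*) [NormedAddCommGroup V] [NormedSpace ℝ V]
    [NormedAddCommGroup W] [NormedSpace ℝ W]
    {M : Type*} [TopologicalSpace M] [ChartedSpace V M]
    [RiemannianBundle (fun x : M => TangentSpace 𝓘(ℝ, V) x)]
    {N : Type*} [TopologicalSpace N] [ChartedSpace W N]
    [RiemannianBundle (fun x : N => TangentSpace 𝓘(ℝ, W) x)]
    (F : M → N) : Prop :=
  ∀ (x : M) (v w : TangentSpace 𝓘(ℝ, V) x),
    ⟪mfderiv 𝓘(ℝ, V) 𝓘(ℝ, W) F x v, mfderiv 𝓘(ℝ, V) 𝓘(ℝ, W) F x w⟫_ℝ = ⟪v, w⟫_ℝ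

/-- `F : M → N` is a Riemannian submersion: it is smooth, each differential
`dF_x : T_x M → T_{F x} N` is onto, and `dF_x` preserves the inner product on the horizontal
space `(ker dF_x)ᗮ`. -/
structure IsRiemannianSubmersion (V W : Type*) [NormedAddCommGroup V] [NormedSpace ℝ V]
    [NormedAddCommGroup W] [NormedSpace ℝ W]
    {M : Type*} [TopologicalSpace M] [ChartedSpace V M]
    [RiemannianBundle (fun x : M => TangentSpace 𝓘(ℝ, V) x)]
    {N : Type*} [TopologicalSpace N] [ChartedSpace W N]
    [RiemannianBundle (fun x : N => TangentSpace 𝓘(ℝ, W) x)]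
    (F : M → N) : Prop where
  contMDiff : ContMDiff 𝓘(ℝ, V) 𝓘(ℝ, W) ∞ F
  surjective_mfderiv : ∀ x : M, Function.Surjective (mfderiv 𝓘(ℝ, V) 𝓘(ℝ, W) F x)
  inner_mfderiv : ∀ x : M,
    ∀ v ∈ (mfderiv 𝓘(ℝ, V) 𝓘(ℝ, W) F x).kerᗮ, ∀ w ∈ (mfderiv 𝓘(ℝ, V) 𝓘(ℝ, W) F x).kerᗮ,
      ⟪mfderiv 𝓘(ℝ, V) 𝓘(ℝ, W) F x v, mfderiv 𝓘(ℝ, V) 𝓘(ℝ, W) F x w⟫_ℝ = ⟪v, w⟫_ℝ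

/-- `v` is the Riemannian gradient `∇f(x)`: `f` is differentiable at `x` and `df_x = ⟨v, ·⟩`. -/
def HasRiemannianGradientAt (V : Type*) [NormedAddCommGroup V] [NormedSpace ℝ V]
    {M : Type*} [TopologicalSpace M] [ChartedSpace V M]
    [RiemannianBundle (fun x : M => TangentSpace 𝓘(ℝ, V) x)]
    (f : M → ℝ) (x : M) (v : TangentSpace 𝓘(ℝ, V) x) : Prop :=
  HasMFDerivAt 𝓘(ℝ, V) 𝓘(ℝ, ℝ) f x (innerSL ℝ v)

/-- The injective homomorphism `φ : H → G` of Lie groups presents its image as a Lie subgroup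
(not necessarily closed) of `G`: it is a smooth injective immersion. -/
structure IsLieSubgroupInclusion (W V : Type*) [NormedAddCommGroup W] [NormedSpace ℝ W]
    [NormedAddCommGroup V] [NormedSpace ℝ V]
    {H : Type*} [TopologicalSpace H] [ChartedSpace W H] [Group H]
    {G : Type*} [TopologicalSpace G] [ChartedSpace V G] [Group G]
    (φ : H →* G) : Prop where
  contMDiff : ContMDiff 𝓘(ℝ, W) 𝓘(ℝ, V) ∞ φ
  injective : Function.Injective φ
  injective_mfderiv : ∀ h : H, Function.Injective (mfderiv 𝓘(ℝ, W) 𝓘(ℝ, V) φ h)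

/-- The Lie algebra of the Lie subgroup `φ(H)` as a subspace of the Lie algebra `T_1 G` of `G`:
the image of `T_1 H` under the differential of `φ` at `1`. (The differential takes values in the
tangent space at `φ 1`, which is carried to the tangent space at `1` along `φ 1 = 1`.) -/
noncomputable def lieSubgroupLieAlgebra (W V : Type*) [NormedAddCommGroup W] [NormedSpace ℝ W]
    [NormedAddCommGroup V] [NormedSpace ℝ V]
    {H : Type*} [TopologicalSpace H] [ChartedSpace W H] [Group H]
    {G : Type*} [TopologicalSpace G] [ChartedSpace V G] [Group G]
    (φ : H →* G) : Submodule ℝ (TangentSpace 𝓘(ℝ, V) (1 : G)) :=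
  Eq.rec (motive := fun (g : G) _ => Submodule ℝ (TangentSpace 𝓘(ℝ, V) g))
    (mfderiv 𝓘(ℝ, W) 𝓘(ℝ, V) φ 1).range (map_one φ)

/-- `f : E → ℝ` is invariant under the subgroup `K` of a group acting on `E`. -/
def IsInvariantUnder {G E : Type*} [Group G] [MulAction G E] (K : Subgroup G) (f : E → ℝ) : Prop :=
  ∀ g ∈ K, ∀ x : E, f (g • x) = f x

/-- The subspace `{∇f(x) ; f : E → ℝ is K-invariant}` of `T_x E` (over those invariant `f` that
have a gradient at `x`). -/
def invariantGradientSpace (V : Type*) [NormedAddCommGroup V] [NormedSpace ℝ V]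
    {E : Type*} [TopologicalSpace E] [ChartedSpace V E]
    [RiemannianBundle (fun x : E => TangentSpace 𝓘(ℝ, V) x)]
    {G : Type*} [Group G] [MulAction G E] (K : Subgroup G) (x : E) :
    Submodule ℝ (TangentSpace 𝓘(ℝ, V) x) where
  carrier := {v | ∃ f : E → ℝ, IsInvariantUnder K f ∧ HasRiemannianGradientAt V f x v}
  zero_mem' := by
    refine ⟨fun _ => 0, fun _ _ _ => rfl, ?_⟩
    unfold HasRiemannianGradientAt
    rw [map_zero]
    exact hasMFDerivAt_const (0 : ℝ) x
  add_mem' := by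
    rintro v w ⟨f, hf, hfv⟩ ⟨f', hf', hfw⟩
    refine ⟨f + f', fun g hg y => ?_, ?_⟩
    · simp only [Pi.add_apply, hf g hg y, hf' g hg y]
    · unfold HasRiemannianGradientAt at *
      rw [map_add]
      exact hfv.add hfw
  smul_mem' := by
    rintro c v ⟨f, hf, hfv⟩
    refine ⟨c • f, fun g hg y => ?_, ?_⟩
    · simp only [Pi.smul_apply, hf g hg y]
    · unfold HasRiemannianGradientAt at *
      rw [map_smul]
      exact hfv.const_smul c

/-- The inequality `∑ i, d i • P_{K i} ≤ Id` between symmetric linear maps of the Euclidean space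
`F`, where `P_{K i}` is the orthogonal projection onto the subspace `K i`. -/
def ProjectionSumLEId {F : Type*} [NormedAddCommGroup F] [InnerProductSpace ℝ F]
    [FiniteDimensional ℝ F] {m : ℕ} (d : Fin m → ℝ) (K : Fin m → Submodule ℝ F) : Prop :=
  ∑ i, d i • (K i).starProjection ≤ ContinuousLinearMap.id ℝ F

/-! The orbit map through a point `x = a • o`, `g ↦ g • x`, is right translation by `a` (an
isometry) followed by the Riemannian submersion `g ↦ g • o`. Hence its differential
`A : 𝒢 → T_x E` at the identity is a coisometry, that is, its adjoint `A† : T_x E → 𝒢` is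
norm-preserving (`norm_adjoint_of_inner_map_orthogonal_ker`). If `f` is `G_i`-invariant and
differentiable at `x`, then `g ↦ f (g • x)` is constant on `G_i`, so its differential
`⟨∇f(x), A ·⟩ = ⟨A† ∇f(x), ·⟩` vanishes on `𝒢_i`
(`HasMFDerivAt.apply_eq_zero_of_mem_lieSubgroupLieAlgebra`): the isometric embedding `A†` maps
`ℰ_i(x)` into `ℰ_i`. Consequently `⟨P_{ℰ_i(x)} u, u⟩ ≤ ⟨P_{ℰ_i} A† u, A† u⟩` for `u ∈ T_x E`, and
the inequality on `𝒢`, evaluated at `A† u`, gives the inequality on `T_x E`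
(`ProjectionSumLEId.of_norm_preserving`). -/

open ContinuousLinearMap in
/-- A surjective map that preserves the inner product on the orthogonal complement of its kernel is
a coisometry. -/
theorem norm_adjoint_of_inner_map_orthogonal_ker {F F' : Type*}
    [NormedAddCommGroup F] [InnerProductSpace ℝ F] [FiniteDimensional ℝ F]
    [NormedAddCommGroup F'] [InnerProductSpace ℝ F'] [CompleteSpace F] [CompleteSpace F']
    (A : F →L[ℝ] F') (hA : Function.Surjective A)
    (hin : ∀ v ∈ A.kerᗮ, ∀ w ∈ A.kerᗮ, ⟪A v, A w⟫_ℝ = ⟪v, w⟫_ℝ) (u : F') :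
    ‖adjoint A u‖ = ‖u‖ := by
  have map_proj : ∀ v, A (A.kerᗮ.starProjection v) = A v := fun v => by
    have h : v - A.kerᗮ.starProjection v ∈ A.ker := by
      have := A.kerᗮ.sub_starProjection_mem_orthogonal v
      rwa [Submodule.orthogonal_orthogonal] at this
    have h0 : A (v - A.kerᗮ.starProjection v) = 0 := h
    rw [map_sub, sub_eq_zero] at h0
    exact h0.symm
  obtain ⟨w₀, rfl⟩ := hA u
  set w := A.kerᗮ.starProjection w₀ with hw
  have hwm : w ∈ A.kerᗮ := Submodule.starProjection_apply_mem _ _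
  -- Tested against `v`, which may be replaced by its projection to `A.kerᗮ` on both sides.
  have key : adjoint A (A w) = w := ext_inner_right ℝ fun v => by
    rw [adjoint_inner_left, ← map_proj v, hin _ hwm _ (Submodule.starProjection_apply_mem _ _),
      ← Submodule.inner_starProjection_left_eq_right,
      Submodule.starProjection_eq_self_iff.2 hwm]
  rw [← map_proj w₀, ← hw, key]
  have h := hin w hwm w hwm
  rw [real_inner_self_eq_norm_sq, real_inner_self_eq_norm_sq] at h
  exact ((sq_eq_sq₀ (norm_nonneg _) (norm_nonneg _)).1 h).symm

theorem real_inner_starProjection_self {F : Type*} [NormedAddCommGroup F] [InnerProductSpace ℝ F]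
    (K : Submodule ℝ F) [K.HasOrthogonalProjection] (u : F) :
    ⟪K.starProjection u, u⟫_ℝ = ‖K.starProjection u‖ ^ 2 := by
  rw [← real_inner_self_eq_norm_sq, ← Submodule.inner_starProjection_left_eq_right,
    Submodule.starProjection_eq_self_iff.2 (Submodule.starProjection_apply_mem _ _)]

theorem projectionSumLEId_iff {F : Type*} [NormedAddCommGroup F] [InnerProductSpace ℝ F]
    [FiniteDimensional ℝ F] {m : ℕ} {d : Fin m → ℝ} {K : Fin m → Submodule ℝ F} :
    ProjectionSumLEId d K ↔ ∀ u, ∑ i, d i * ‖(K i).starProjection u‖ ^ 2 ≤ ‖u‖ ^ 2 := by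
  have hs : ((ContinuousLinearMap.id ℝ F - ∑ i, d i • (K i).starProjection : F →L[ℝ] F) :
      F →ₗ[ℝ] F).IsSymmetric := by
    intro u v
    simp [inner_sub_left, inner_sub_right, sum_inner, inner_sum, real_inner_smul_left,
      real_inner_smul_right, Submodule.inner_starProjection_left_eq_right]
  have hq : ∀ u, ⟪(ContinuousLinearMap.id ℝ F - ∑ i, d i • (K i).starProjection) u, u⟫_ℝ =
      ‖u‖ ^ 2 - ∑ i, d i * ‖(K i).starProjection u‖ ^ 2 := by
    intro u
    simp [inner_sub_left, sum_inner, real_inner_smul_left, real_inner_starProjection_self]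
  rw [ProjectionSumLEId, ContinuousLinearMap.le_def, ContinuousLinearMap.isPositive_def]
  refine ⟨fun h u => ?_, fun h => ⟨hs, fun u => ?_⟩⟩
  · have := h.2 u
    rw [ContinuousLinearMap.reApplyInnerSelf_apply, RCLike.re_to_real, hq] at this
    linarith
  · rw [ContinuousLinearMap.reApplyInnerSelf_apply, RCLike.re_to_real, hq]
    linarith [h u]

/-- The inequality `∑ i, d i • P_{K i} ≤ Id` passes to subspaces `L i` that are mapped into the
`K i` by a norm-preserving linear map. -/
theorem ProjectionSumLEId.of_norm_preserving {F F' : Type*}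
    [NormedAddCommGroup F] [InnerProductSpace ℝ F] [FiniteDimensional ℝ F]
    [NormedAddCommGroup F'] [InnerProductSpace ℝ F'] [FiniteDimensional ℝ F'] {m : ℕ}
    {d : Fin m → ℝ} (hd : ∀ i, 0 ≤ d i) {K : Fin m → Submodule ℝ F} {L : Fin m → Submodule ℝ F'}
    (T : F' →L[ℝ] F) (hT : ∀ u, ‖T u‖ = ‖u‖) (hTL : ∀ i, ∀ v ∈ L i, T v ∈ K i)
    (h : ProjectionSumLEId d K) : ProjectionSumLEId d L := by
  rw [projectionSumLEId_iff] at h ⊢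
  intro u
  rw [← hT u]
  refine (Finset.sum_le_sum fun i _ => mul_le_mul_of_nonneg_left ?_ (hd i)).trans (h (T u))
  set p := (L i).starProjection u
  have hp : p ∈ L i := Submodule.starProjection_apply_mem _ _
  -- `T` preserves inner products, so `‖p‖² = ⟪p, u⟫ = ⟪T p, T u⟫ = ⟪T p, P_{K i} (T u)⟫`.
  have hpp : ‖p‖ ^ 2 = ⟪T p, (K i).starProjection (T u)⟫_ℝ := by
    rw [← Submodule.inner_starProjection_left_eq_right,
      Submodule.starProjection_eq_self_iff.2 (hTL i p hp),
      (LinearMap.norm_map_iff_inner_map_map T).1 hT p u, real_inner_starProjection_self]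
  have hle : ‖p‖ ^ 2 ≤ ‖p‖ * ‖(K i).starProjection (T u)‖ := by
    rw [hpp]
    exact (real_inner_le_norm _ _).trans_eq (by rw [hT])
  nlinarith [sq_nonneg (‖p‖ - ‖(K i).starProjection (T u)‖)]

/-- A function that is constant on the Lie subgroup `φ(H)` has vanishing differential along its Lie
algebra. -/
theorem HasMFDerivAt.apply_eq_zero_of_mem_lieSubgroupLieAlgebra
    {W V : Type*} [NormedAddCommGroup W] [NormedSpace ℝ W]
    [NormedAddCommGroup V] [NormedSpace ℝ V]
    {H : Type*} [TopologicalSpace H] [ChartedSpace W H] [Group H]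
    {G : Type*} [TopologicalSpace G] [ChartedSpace V G] [Group G]
    {φ : H →* G} (hφ : MDifferentiableAt 𝓘(ℝ, W) 𝓘(ℝ, V) φ 1) {k : G → ℝ} {c : ℝ}
    (hk : ∀ h, k (φ h) = c) {L : TangentSpace 𝓘(ℝ, V) (1 : G) →L[ℝ] ℝ}
    (hL : HasMFDerivAt 𝓘(ℝ, V) 𝓘(ℝ, ℝ) k 1 L)
    {v : TangentSpace 𝓘(ℝ, V) (1 : G)} (hv : v ∈ lieSubgroupLieAlgebra W V φ) : L v = 0 := by
  -- `φ 1` and `1` are not definitionally equal, so the base point is generalized.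
  have key : ∀ (g : G) (hg : φ 1 = g) (L : TangentSpace 𝓘(ℝ, V) g →L[ℝ] ℝ),
      HasMFDerivAt 𝓘(ℝ, V) 𝓘(ℝ, ℝ) k g L → ∀ v : TangentSpace 𝓘(ℝ, V) g,
      v ∈ (Eq.rec (motive := fun (g : G) _ => Submodule ℝ (TangentSpace 𝓘(ℝ, V) g))
        (mfderiv 𝓘(ℝ, W) 𝓘(ℝ, V) φ 1).range hg :
          Submodule ℝ (TangentSpace 𝓘(ℝ, V) g)) → L v = 0 := by
    rintro g rfl L hL v ⟨w, rfl⟩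
    have h1 := hL.comp (1 : H) hφ.hasMFDerivAt
    have h2 : k ∘ φ = fun _ => c := funext hk
    rw [h2] at h1
    exact DFunLike.congr_fun (hasMFDerivAt_unique h1 (hasMFDerivAt_const c (1 : H))) w
  exact key 1 (map_one φ) L hL v hv

theorem lemma13
    -- `G`: a connected compact Lie group with a smooth bi-invariant Riemannian metric
    {VG : Type*} [NormedAddCommGroup VG] [NormedSpace ℝ VG] [FiniteDimensional ℝ VG]
    {G : Type*} [TopologicalSpace G] [T2Space G] [CompactSpace G] [ConnectedSpace G]
    [ChartedSpace VG G] [Group G] [LieGroup 𝓘(ℝ, VG) ∞ G]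
    [RiemannianBundle (fun g : G => TangentSpace 𝓘(ℝ, VG) g)]
    [IsContMDiffRiemannianBundle 𝓘(ℝ, VG) ∞ VG (fun g : G => TangentSpace 𝓘(ℝ, VG) g)]
    (hleft : ∀ a : G, PreservesRiemannianMetric VG VG (fun g : G => a * g))
    (hright : ∀ a : G, PreservesRiemannianMetric VG VG (fun g : G => g * a))
    -- `E`: a Riemannian manifold on which `G` acts smoothly, isometrically and transitively
    {VE : Type*} [NormedAddCommGroup VE] [NormedSpace ℝ VE] [FiniteDimensional ℝ VE]
    {E : Type*} [TopologicalSpace E] [T2Space E] [ChartedSpace VE E] [IsManifold 𝓘(ℝ, VE) ∞ E]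
    [RiemannianBundle (fun x : E => TangentSpace 𝓘(ℝ, VE) x)]
    [IsContMDiffRiemannianBundle 𝓘(ℝ, VE) ∞ VE (fun x : E => TangentSpace 𝓘(ℝ, VE) x)]
    [MulAction G E] [ContMDiffSMul 𝓘(ℝ, VG) 𝓘(ℝ, VE) ∞ G E] [MulAction.IsPretransitive G E]
    (hisom : ∀ g : G, PreservesRiemannianMetric VE VE (fun x : E => g • x))
    -- the metric of `E` is the quotient metric of `E = G / G_o`
    (o : E) (hquot : IsRiemannianSubmersion VG VE (fun g : G => g • o))
    -- `φ i (H i)`: connected Lie subgroups of `G`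
    {m : ℕ} {VH : Fin m → Type*} [∀ i, NormedAddCommGroup (VH i)] [∀ i, NormedSpace ℝ (VH i)]
    [∀ i, FiniteDimensional ℝ (VH i)]
    {H : Fin m → Type*} [∀ i, TopologicalSpace (H i)] [∀ i, ConnectedSpace (H i)]
    [∀ i, ChartedSpace (VH i) (H i)] [∀ i, Group (H i)] [∀ i, LieGroup 𝓘(ℝ, VH i) ∞ (H i)]
    (φ : ∀ i, H i →* G) (hφ : ∀ i, IsLieSubgroupInclusion (VH i) VG (φ i))
    (d : Fin m → ℝ) (hd : ∀ i, 0 < d i)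
    -- the inequality of symmetric maps on the Lie algebra of `G`
    (hBL : ProjectionSumLEId (F := TangentSpace 𝓘(ℝ, VG) (1 : G)) d
      (fun i => (lieSubgroupLieAlgebra (VH i) VG (φ i)).orthogonal)) :
    ∀ x : E, ProjectionSumLEId (F := TangentSpace 𝓘(ℝ, VE) x) d
      (fun i => invariantGradientSpace VE (φ i).range x) := by
  intro x
  -- Writing `x = (1 * a) • o` rather than `a • o` makes the differentials below composable.
  obtain ⟨a, rfl⟩ : ∃ a : G, ((1 : G) * a) • o = x := by
    obtain ⟨a, rfl⟩ := MulAction.exists_smul_eq G o x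
    exact ⟨a, by rw [one_mul]⟩
  let R : TangentSpace 𝓘(ℝ, VG) (1 : G) →L[ℝ] TangentSpace 𝓘(ℝ, VG) ((1 : G) * a) :=
    mfderiv 𝓘(ℝ, VG) 𝓘(ℝ, VG) (fun g : G => g * a) 1
  let S : TangentSpace 𝓘(ℝ, VG) ((1 : G) * a) →L[ℝ] TangentSpace 𝓘(ℝ, VE) (((1 : G) * a) • o) :=
    mfderiv 𝓘(ℝ, VG) 𝓘(ℝ, VE) (fun g : G => g • o) (1 * a)
  have hRd : HasMFDerivAt 𝓘(ℝ, VG) 𝓘(ℝ, VG) (fun g : G => g * a) 1 R :=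
    ((contMDiff_mul_right (I := 𝓘(ℝ, VG)) (n := ∞) (a := a)).mdifferentiable
      (by simp) 1).hasMFDerivAt
  have hSd : HasMFDerivAt 𝓘(ℝ, VG) 𝓘(ℝ, VE) (fun g : G => g • o) (1 * a) S :=
    (hquot.contMDiff.mdifferentiable (by simp) _).hasMFDerivAt
  have hRin : ∀ v w, ⟪R v, R w⟫_ℝ = ⟪v, w⟫_ℝ := hright a 1
  have hRinj : Function.Injective R := by
    refine (injective_iff_map_eq_zero R).2 fun v hv => ?_
    rw [← inner_self_eq_zero (𝕜 := ℝ), ← hRin, hv, inner_zero_left]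
  -- `R` is an injective map between spaces of the same finite dimension.
  have hRsurj : Function.Surjective R :=
    (LinearMap.injective_iff_surjective_of_finrank_eq_finrank (f := R.toLinearMap) rfl).1 hRinj
  have hR := norm_adjoint_of_inner_map_orthogonal_ker R hRsurj fun v _ w _ => hRin v w
  have hS := norm_adjoint_of_inner_map_orthogonal_ker S (hquot.surjective_mfderiv _)
    (hquot.inner_mfderiv _)
  refine hBL.of_norm_preserving (fun i => (hd i).le)
    (ContinuousLinearMap.adjoint R ∘L ContinuousLinearMap.adjoint S)
    (fun u => (hR _).trans (hS u)) ?_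
  rintro i v ⟨f, hf, hfv⟩
  rw [Submodule.mem_orthogonal']
  intro w hw
  -- `hder` is the derivative at `1` of `g ↦ f ((g * a) • o)`, which is constant on `φ i (H i)`.
  have hfd : HasMFDerivAt 𝓘(ℝ, VE) 𝓘(ℝ, ℝ) f (((1 : G) * a) • o) (innerSL ℝ v) := hfv
  have hfS := HasMFDerivAt.comp (f := fun g : G => g • o) ((1 : G) * a) hfd hSd
  have hder := HasMFDerivAt.comp (f := fun g : G => g * a) (1 : G) hfS hRd
  have h0 := hder.apply_eq_zero_of_mem_lieSubgroupLieAlgebra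
    (c := f (((1 : G) * a) • o)) ((hφ i).contMDiff.mdifferentiable (by simp) 1)
    (fun h => by
      have := hf (φ i h) ⟨h, rfl⟩ (((1 : G) * a) • o)
      simpa only [Function.comp_apply, smul_smul, one_mul] using this) hw
  rw [ContinuousLinearMap.comp_apply, ContinuousLinearMap.adjoint_inner_left,
    ContinuousLinearMap.adjoint_inner_left]
  exact h0
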